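/- For a graph $H$, the problem *$H$-free Edge Deletion*, parameterized by $k$, is: given a finite simple graph $G$ and an integer $k\ge 0$, decide whether there is a set $F\subseteq E(G)$ with $|F|\le k$ such that $G-F$ (the graph $(V(G),E(G)\setminus F)$) contains no induced copy of $H$. A *linear parameterized reduction* from a parameterized problem $A$ to a parameterized problem $B$ is a map, computable in time polynomial in the size of the input, that sends every instance $x$ of $A$ with parameter $k$ to an instance $x'$ of $B$ with parameter $k'=O(k)$ such that $x$ is a yes-instance of $A$ if and only if $x'$ is a yes-instance of $B$. (Here an instance $(G,k)$ is given by $k$ in binary, the number of vertices of $G$, and the adjacency matrix of $G$.) Let $r>2$ and let $R$ be a finite connected simple $r$-regular graph. Let $V'\subseteq V(R)$ be a set of vertices such that the induced subgraph $R[V']$ is isomorphic to the path $P_3$ on three vertices or to the triangle $K_3$, and such that $R-V'$ (the graph obtained from $R$ by deleting the vertices in $V'$) is connected. Then there is a linear parameterized reduction from $R[V']$-free Edge Deletion to $R$-free Edge Deletion. -/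

import Mathlib

/-! ## Random access machine with unit step count

Registers and memory cells hold natural numbers. The only arithmetic is addition and truncated
subtraction, so one step lengthens the binary representation of the largest stored number by at most
one bit; hence the number of steps is polynomially related to the running time of a Turing
machine. -/

namespace RAM

/-- Programs of the machine. Registers are named by natural numbers; a program mentions only
finitely many of them. The memory is accessed through addresses held in registers. -/
inductive Prog : Type
  /-- `x := c` -/
  | const (x c : ℕ) : Prog
  /-- `x := y + z` -/
  | add (x y z : ℕ) : Prog
  /-- `x := max (y - z) 0` -/
  | sub (x y z : ℕ) : Prog
  /-- `x := memory[y]` -/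
  | load (x y : ℕ) : Prog
  /-- `memory[x] := y` -/
  | store (x y : ℕ) : Prog
  /-- Move the next number of the input into `x` (`0` if the input is exhausted). -/
  | read (x : ℕ) : Prog
  /-- Append the content of `x` to the output. -/
  | print (x : ℕ) : Prog
  /-- First `p`, then `q`. -/
  | seq (p q : Prog) : Prog
  /-- If `x ≠ 0` then `p` else `q`. -/
  | cond (x : ℕ) (p q : Prog) : Prog
  /-- While `x ≠ 0` do `p`. -/
  | loop (x : ℕ) (p : Prog) : Prog

/-- A configuration: registers, memory, the unread part of the input, the output so far. -/
structure State : Type where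
  reg : ℕ → ℕ
  mem : ℕ → ℕ
  input : List ℕ
  output : List ℕ

/-- Assign the value `v` to the register `x`. -/
def State.setReg (s : State) (x v : ℕ) : State :=
  { s with reg := Function.update s.reg x v }

/-- The initial configuration on input `w`. -/
def State.init (w : List ℕ) : State where
  reg := fun _ => 0
  mem := fun _ => 0
  input := w
  output := []

/-- `Exec p s t s'`: started in `s`, the program `p` halts in `s'` after exactly `t` steps.
Every elementary instruction and every test of a register counts as one step. -/
inductive Exec : Prog → State → ℕ → State → Prop
  | const (x c : ℕ) (s : State) : Exec (.const x c) s 1 (s.setReg x c)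
  | add (x y z : ℕ) (s : State) : Exec (.add x y z) s 1 (s.setReg x (s.reg y + s.reg z))
  | sub (x y z : ℕ) (s : State) : Exec (.sub x y z) s 1 (s.setReg x (s.reg y - s.reg z))
  | load (x y : ℕ) (s : State) : Exec (.load x y) s 1 (s.setReg x (s.mem (s.reg y)))
  | store (x y : ℕ) (s : State) :
      Exec (.store x y) s 1 { s with mem := Function.update s.mem (s.reg x) (s.reg y) }
  | read (x : ℕ) (s : State) :
      Exec (.read x) s 1 { s.setReg x (s.input.headD 0) with input := s.input.tail }
  | print (x : ℕ) (s : State) :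
      Exec (.print x) s 1 { s with output := s.output ++ [s.reg x] }
  | seq {p q : Prog} {s₀ s₁ s₂ : State} {t₁ t₂ : ℕ} :
      Exec p s₀ t₁ s₁ → Exec q s₁ t₂ s₂ → Exec (.seq p q) s₀ (t₁ + t₂) s₂
  | condTrue {x : ℕ} {p q : Prog} {s s' : State} {t : ℕ} :
      s.reg x ≠ 0 → Exec p s t s' → Exec (.cond x p q) s (t + 1) s'
  | condFalse {x : ℕ} {p q : Prog} {s s' : State} {t : ℕ} :
      s.reg x = 0 → Exec q s t s' → Exec (.cond x p q) s (t + 1) s'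
  | loopDone {x : ℕ} {p : Prog} {s : State} :
      s.reg x = 0 → Exec (.loop x p) s 1 s
  | loopStep {x : ℕ} {p : Prog} {s₀ s₁ s₂ : State} {t₁ t₂ : ℕ} :
      s₀.reg x ≠ 0 → Exec p s₀ t₁ s₁ → Exec (.loop x p) s₁ t₂ s₂ →
        Exec (.loop x p) s₀ (t₁ + t₂ + 1) s₂

/-- The size of a word: the total number of binary digits of its entries, plus one separator
for each entry. -/
def wordSize (w : List ℕ) : ℕ := (w.map fun x => Nat.size x + 1).sum

/-- `f` is computable in polynomial time, where the objects of `α` and `β` are represented by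
words through `encA` and `encB`: one program turns, for every `a`, the code of `a` into the code
of `f a`, in a number of steps polynomial in the size of the code of `a`. -/
def PolyTimeComputable {α β : Type} (encA : α → List ℕ) (encB : β → List ℕ) (f : α → β) : Prop :=
  ∃ (P : Prog) (p : Polynomial ℕ), ∀ a : α, ∃ (t : ℕ) (s : State),
    Exec P (State.init (encA a)) t s ∧ t ≤ p.eval (wordSize (encA a)) ∧ s.output = encB (f a)

end RAM

/-! ## Parameterized problems and reductions -/

/-- A parameterized decision problem: instances with their codes, the parameter of an instance,
and the set of yes-instances. -/
structure ParamProblem : Type 1 where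
  Inst : Type
  encode : Inst → List ℕ
  encode_injective : Function.Injective encode
  param : Inst → ℕ
  yes : Set Inst

/-- There is a linear parameterized reduction from `A` to `B`: a polynomial time computable map
from the instances of `A` to those of `B` that preserves and reflects yes-instances and
increases the parameter at most linearly. -/
def LinearParamReducible (A B : ParamProblem) : Prop :=
  ∃ f : A.Inst → B.Inst,
    RAM.PolyTimeComputable A.encode B.encode f ∧
    (∀ a, a ∈ A.yes ↔ f a ∈ B.yes) ∧
    ∃ c : ℕ, ∀ a, B.param (f a) ≤ c * A.param a

/-! ## Induced-subgraph-free edge deletion -/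

/-- An instance `(G, k)`: a finite simple graph `G` with vertex set `{0, …, n - 1}` and a
natural number `k`. -/
structure GraphInstance : Type where
  n : ℕ
  G : SimpleGraph (Fin n)
  k : ℕ

/-- The adjacency matrix of `G`, row by row, as a list of `n * n` zeros and ones. -/
noncomputable def adjWord {n : ℕ} (G : SimpleGraph (Fin n)) : List ℕ :=
  open Classical in
  (List.finRange n).flatMap fun u =>
    (List.finRange n).map fun v => if G.Adj u v then 1 else 0

/-- The code of `(G, k)`: the number `k`, the number of vertices, and the adjacency matrix. -/
noncomputable def GraphInstance.encode (I : GraphInstance) : List ℕ :=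
  I.k :: I.n :: adjWord I.G

theorem adjWord_injective (n : ℕ) :
    Function.Injective (adjWord : SimpleGraph (Fin n) → List ℕ) := by
  classical
  intro G G' h
  have key : ∀ (l : List (Fin n)) (f g : Fin n → List ℕ), (∀ u, (f u).length = (g u).length) →
      l.flatMap f = l.flatMap g → ∀ u ∈ l, f u = g u := by
    intro l f g hl
    induction l with
    | nil => simp
    | cons a l ih =>
      intro h
      rw [List.flatMap_cons, List.flatMap_cons] at h
      obtain ⟨h1, h2⟩ := List.append_inj h (hl a)
      intro u hu
      rcases List.mem_cons.1 hu with rfl | hu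
      · exact h1
      · exact ih h2 u hu
  have h1 := key _ _ _ (fun u => by simp) h
  ext u v
  have h2 := List.map_inj_left.1 (h1 u (List.mem_finRange u)) v (List.mem_finRange v)
  by_cases a : G.Adj u v <;> by_cases b : G'.Adj u v <;> simp_all

theorem GraphInstance.encode_injective : Function.Injective GraphInstance.encode := by
  rintro ⟨n, G, k⟩ ⟨n', G', k'⟩ h
  simp only [GraphInstance.encode, List.cons.injEq] at h
  obtain ⟨rfl, rfl, h⟩ := h
  rw [adjWord_injective n h]

/-- The problem `H`-free Edge Deletion, parameterized by `k`: given `(G, k)`, are there at most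
`k` edges of `G` whose deletion results in a graph without an induced copy of `H`? -/
noncomputable def edgeDeletion {V : Type*} (H : SimpleGraph V) : ParamProblem where
  Inst := GraphInstance
  encode := GraphInstance.encode
  encode_injective := GraphInstance.encode_injective
  param I := I.k
  yes := {I | ∃ F : Finset (Sym2 (Fin I.n)), (F : Set (Sym2 (Fin I.n))) ⊆ I.G.edgeSet ∧
    F.card ≤ I.k ∧ ¬ H.IsIndContained (I.G.deleteEdges (F : Set (Sym2 (Fin I.n))))}

/-! ## Verification of RAM programs -/

namespace RAM

theorem eval_le_eval (p : Polynomial ℕ) {a b : ℕ} (h : a ≤ b) : p.eval a ≤ p.eval b := by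
  rw [Polynomial.eval_eq_sum_range, Polynomial.eval_eq_sum_range]
  gcongr

/-- Started in `s`, the program `P` halts after at most `T` steps in a state satisfying `Q`. -/
def Run (P : Prog) (s : State) (T : ℕ) (Q : State → Prop) : Prop :=
  ∃ t s', Exec P s t s' ∧ t ≤ T ∧ Q s'

theorem Run.of_exec {P : Prog} {s s' : State} {t : ℕ} {Q : State → Prop} (h : Exec P s t s')
    (hQ : Q s') : Run P s t Q :=
  ⟨t, s', h, le_rfl, hQ⟩

theorem Run.mono {P : Prog} {s : State} {T T' : ℕ} {Q Q' : State → Prop} (h : Run P s T Q)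
    (hT : T ≤ T') (hQ : ∀ s', Q s' → Q' s') : Run P s T' Q' := by
  obtain ⟨t, s', h1, h2, h3⟩ := h
  exact ⟨t, s', h1, h2.trans hT, hQ _ h3⟩

theorem Run.seq {P P' : Prog} {s : State} {T T' : ℕ} {Q Q' : State → Prop} (h : Run P s T Q)
    (h' : ∀ s', Q s' → Run P' s' T' Q') : Run (.seq P P') s (T + T') Q' := by
  obtain ⟨t, s', h1, h2, h3⟩ := h
  obtain ⟨t', s'', h4, h5, h6⟩ := h' s' h3
  exact ⟨_, s'', h1.seq h4, by omega, h6⟩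

theorem Run.step {P P' : Prog} {s s' : State} {t T : ℕ} {Q : State → Prop} (h : Exec P s t s')
    (h' : Run P' s' T Q) : Run (.seq P P') s (t + T) Q :=
  (Run.of_exec (Q := fun x => x = s') h rfl).seq (by rintro _ rfl; exact h')

/-- The rule for loops: `I i` holds before the `i`-th round, and there are `N` rounds. -/
theorem Run.loop {c : ℕ} {P : Prog} {N T : ℕ} {I : ℕ → State → Prop}
    (hc : ∀ i ≤ N, ∀ s, I i s → (s.reg c = 0 ↔ i = N))
    (hP : ∀ i < N, ∀ s, I i s → Run P s T (I (i + 1))) {s : State} (hs : I 0 s) :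
    Run (.loop c P) s (N * (T + 1) + 1) (I N) := by
  suffices H : ∀ m i s, i + m = N → I i s → Run (.loop c P) s (m * (T + 1) + 1) (I N) from
    H N 0 s (by omega) hs
  intro m
  induction m with
  | zero =>
    intro i s hi h
    obtain rfl : i = N := by omega
    exact ⟨1, s, .loopDone ((hc i le_rfl s h).2 rfl), by omega, h⟩
  | succ m ih =>
    intro i s hi h
    obtain ⟨t, s', h1, h2, h3⟩ := hP i (by omega) s h
    obtain ⟨t', s'', h4, h5, h6⟩ := ih (i + 1) s' (by omega) h3
    refine ⟨_, s'', .loopStep (fun h0 => ?_) h1 h4, ?_, h6⟩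
    · have := (hc i (by omega) s h).1 h0
      omega
    · rw [Nat.add_mul]
      omega

/-- `s'` differs from `s` at most in the registers from `d` on. -/
structure Frame (d : ℕ) (s s' : State) : Prop where
  mem : s'.mem = s.mem
  input : s'.input = s.input
  output : s'.output = s.output
  reg : ∀ x < d, s'.reg x = s.reg x

theorem Frame.refl (d : ℕ) (s : State) : Frame d s s := ⟨rfl, rfl, rfl, fun _ _ => rfl⟩

theorem Frame.trans {d d' : ℕ} {s s' s'' : State} (h : Frame d s s') (h' : Frame d' s' s'')
    (hd : d ≤ d') : Frame d s s'' :=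
  ⟨h'.mem.trans h.mem, h'.input.trans h.input, h'.output.trans h.output,
    fun x hx => (h'.reg x (by omega)).trans (h.reg x hx)⟩

theorem Frame.setReg {d x v : ℕ} {s s' : State} (h : Frame d s s') (hx : d ≤ x) :
    Frame d s (s'.setReg x v) :=
  ⟨h.mem, h.input, h.output, fun y hy => by
    simp [State.setReg, Function.update_of_ne (show y ≠ x by omega), h.reg y hy]⟩

theorem State.reg_setReg (s : State) (x v y : ℕ) :
    (s.setReg x v).reg y = if y = x then v else s.reg y := by
  simp [State.setReg, Function.update_apply]

/-- A function of the registers `0`, `1`, `2` and of the memory that can be evaluated in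
polynomial time, without changing the registers below `d`, leaving the value in register `d`. -/
def Evaluable (f : ℕ → ℕ → ℕ → (ℕ → ℕ) → ℕ) : Prop :=
  ∀ d, 3 ≤ d → ∃ (P : Prog) (p : Polynomial ℕ), ∀ (s : State) (B : ℕ),
    (∀ x < 3, s.reg x ≤ B) → (∀ a, s.mem a ≤ B) →
    f (s.reg 0) (s.reg 1) (s.reg 2) s.mem ≤ p.eval B ∧
    Run P s (p.eval B) fun s' =>
      Frame d s s' ∧ s'.reg d = f (s.reg 0) (s.reg 1) (s.reg 2) s.mem

/-- A binary operation on the registers `d` and `d + 1` that can be evaluated in polynomial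
time. -/
def EvaluableOp (g : ℕ → ℕ → ℕ) : Prop :=
  ∀ d, ∃ (P : Prog) (p : Polynomial ℕ), ∀ (s : State) (B : ℕ),
    s.reg d ≤ B → s.reg (d + 1) ≤ B →
    g (s.reg d) (s.reg (d + 1)) ≤ p.eval B ∧
    Run P s (p.eval B) fun s' => Frame d s s' ∧ s'.reg d = g (s.reg d) (s.reg (d + 1))

theorem EvaluableOp.comp {g : ℕ → ℕ → ℕ} (hg : EvaluableOp g) {f h : ℕ → ℕ → ℕ → (ℕ → ℕ) → ℕ}
    (hf : Evaluable f) (hh : Evaluable h) : Evaluable fun n u v m => g (f n u v m) (h n u v m) := by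
  intro d hd
  obtain ⟨P₁, p₁, H₁⟩ := hf d hd
  obtain ⟨P₂, p₂, H₂⟩ := hh (d + 1) (by omega)
  obtain ⟨P₃, p₃, H₃⟩ := hg d
  refine ⟨.seq P₁ (.seq P₂ P₃), p₁ + (p₂ + p₃.comp (p₁ + p₂)), fun s B hs hm => ?_⟩
  obtain ⟨b₁, r₁⟩ := H₁ s B hs hm
  have key : ∀ s', Frame d s s' → s'.reg d = f (s.reg 0) (s.reg 1) (s.reg 2) s.mem →
      h (s.reg 0) (s.reg 1) (s.reg 2) s.mem ≤ p₂.eval B ∧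
      Run P₂ s' (p₂.eval B) fun s'' => Frame d s s'' ∧
        s''.reg d = f (s.reg 0) (s.reg 1) (s.reg 2) s.mem ∧
        s''.reg (d + 1) = h (s.reg 0) (s.reg 1) (s.reg 2) s.mem := by
    intro s' hF e
    have e0 := hF.reg 0 (by omega)
    have e1 := hF.reg 1 (by omega)
    have e2 := hF.reg 2 (by omega)
    obtain ⟨b₂, r₂⟩ := H₂ s' B (fun x hx => by rw [hF.reg x (by omega)]; exact hs x hx)
      (by rw [hF.mem]; exact hm)
    rw [e0, e1, e2, hF.mem] at b₂ r₂
    exact ⟨b₂, r₂.mono le_rfl fun s'' h => ⟨hF.trans h.1 (by omega),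
      (h.1.reg d (by omega)).trans e, h.2⟩⟩
  have b₂ : h (s.reg 0) (s.reg 1) (s.reg 2) s.mem ≤ p₂.eval B := by
    obtain ⟨t, s', -, -, hF, e⟩ := r₁
    exact (key s' hF e).1
  have main : ∀ s', Frame d s s' → s'.reg d = f (s.reg 0) (s.reg 1) (s.reg 2) s.mem →
      s'.reg (d + 1) = h (s.reg 0) (s.reg 1) (s.reg 2) s.mem →
      g (f (s.reg 0) (s.reg 1) (s.reg 2) s.mem) (h (s.reg 0) (s.reg 1) (s.reg 2) s.mem) ≤
        p₃.eval (p₁.eval B + p₂.eval B) ∧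
      Run P₃ s' (p₃.eval (p₁.eval B + p₂.eval B)) fun s'' => Frame d s s'' ∧ s''.reg d =
        g (f (s.reg 0) (s.reg 1) (s.reg 2) s.mem) (h (s.reg 0) (s.reg 1) (s.reg 2) s.mem) := by
    intro s' hF e e'
    obtain ⟨b₃, r₃⟩ := H₃ s' (p₁.eval B + p₂.eval B) (by omega) (by omega)
    rw [e, e'] at b₃ r₃
    exact ⟨b₃, r₃.mono le_rfl fun s'' h => ⟨hF.trans h.1 le_rfl, h.2⟩⟩
  simp only [Polynomial.eval_add, Polynomial.eval_comp]
  constructor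
  · obtain ⟨t, s', -, -, hF, e⟩ := r₁
    obtain ⟨t, s'', -, -, hF', e', e''⟩ := (key s' hF e).2
    have := (main s'' hF' e' e'').1
    omega
  · exact r₁.seq fun s' h => (key s' h.1 h.2).2.seq fun s'' h => (main s'' h.1 h.2.1 h.2.2).2

theorem evaluableOp_add : EvaluableOp fun x y => x + y := by
  refine fun d => ⟨.add d d (d + 1), Polynomial.X + Polynomial.X + 1, fun s B h h' => ?_⟩
  simp only [Polynomial.eval_add, Polynomial.eval_X, Polynomial.eval_one]
  exact ⟨by omega, (Run.of_exec (.add d d (d + 1) s)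
    ⟨(Frame.refl d s).setReg le_rfl, by simp [State.reg_setReg]⟩).mono (by omega) fun _ => id⟩

theorem evaluableOp_sub : EvaluableOp fun x y => x - y := by
  refine fun d => ⟨.sub d d (d + 1), Polynomial.X + 1, fun s B h h' => ?_⟩
  simp only [Polynomial.eval_add, Polynomial.eval_X, Polynomial.eval_one]
  exact ⟨by omega, (Run.of_exec (.sub d d (d + 1) s)
    ⟨(Frame.refl d s).setReg le_rfl, by simp [State.reg_setReg]⟩).mono (by omega) fun _ => id⟩

theorem evaluableOp_mul : EvaluableOp fun x y => x * y := by
  intro d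
  refine ⟨.seq (.const (d + 2) 0) (.seq (.const (d + 3) 1) (.seq
    (.loop d (.seq (.add (d + 2) (d + 2) (d + 1)) (.sub d d (d + 3)))) (.add d d (d + 2)))),
    Polynomial.X * Polynomial.X + 3 * Polynomial.X + 10, fun s B h h' => ?_⟩
  have hB : Polynomial.eval B (Polynomial.X * Polynomial.X + 3 * Polynomial.X + 10) =
    B * B + 3 * B + 10 := by simp
  rw [hB]
  refine ⟨(Nat.mul_le_mul h h').trans (by omega), ?_⟩
  refine Run.mono (T := 1 + (1 + ((s.reg d * (2 + 1) + 1) + 1))) (Run.step (.const _ _ _)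
    (Run.step (.const _ _ _) (Run.seq (Q := fun s' => Frame d s s' ∧ s'.reg d = 0 ∧
      s'.reg (d + 2) = s.reg d * s.reg (d + 1)) ?_ ?_))) (by nlinarith) (fun _ => id)
  · refine (Run.loop (I := fun i s' => Frame d s s' ∧ s'.reg d = s.reg d - i ∧
      s'.reg (d + 1) = s.reg (d + 1) ∧ s'.reg (d + 2) = i * s.reg (d + 1) ∧ s'.reg (d + 3) = 1)
      ?_ ?_ ?_).mono le_rfl ?_
    · rintro i hi s' ⟨-, h1, -⟩
      omega
    · rintro i hi s' ⟨hF, h1, h2, h3, h4⟩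
      refine Run.step (.add _ _ _ _) (.of_exec (.sub _ _ _ _)
        ⟨(hF.setReg (by omega)).setReg le_rfl, ?_⟩)
      simp [State.reg_setReg, h1, h2, h3, h4, Nat.add_mul]
      omega
    · exact ⟨((Frame.refl d s).setReg (by omega)).setReg (by omega), by simp [State.reg_setReg]⟩
    · rintro s' ⟨hF, h1, -, h2, -⟩
      exact ⟨hF, by omega, h2⟩
  · rintro s' ⟨hF, h1, h2⟩
    exact .of_exec (.add _ _ _ _) ⟨hF.setReg le_rfl, by simp [State.reg_setReg, h1, h2]⟩

theorem evaluableOp_div : EvaluableOp fun x y => x / y := by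
  intro d
  refine ⟨.seq (.const (d + 2) 0) (.seq (.const (d + 3) 1) (.seq (.cond (d + 1)
    (.seq (.add (d + 4) d (d + 3)) (.seq (.sub (d + 4) (d + 4) (d + 1))
      (.loop (d + 4) (.seq (.sub d d (d + 1)) (.seq (.add (d + 2) (d + 2) (d + 3))
        (.seq (.add (d + 4) d (d + 3)) (.sub (d + 4) (d + 4) (d + 1)))))))) (.const (d + 2) 0))
    (.seq (.const d 0) (.add d d (d + 2))))),
    5 * Polynomial.X + 10, fun s B h h' => ?_⟩
  have hB : Polynomial.eval B (5 * Polynomial.X + 10) = 5 * B + 10 := by simp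
  rw [hB]
  have hle := Nat.div_le_self (s.reg d) (s.reg (d + 1))
  refine ⟨hle.trans (by omega), ?_⟩
  refine Run.mono (T := 1 + (1 + ((s.reg d / s.reg (d + 1)) * 5 + 4 + (1 + 1))))
    (Run.step (.const _ _ _)
    (Run.step (.const _ _ _) (Run.seq (Q := fun s' => Frame d s s' ∧
      s'.reg (d + 2) = s.reg d / s.reg (d + 1)) ?_ ?_))) (by omega) (fun _ => id)
  · by_cases hy : s.reg (d + 1) = 0
    · refine ⟨2, _, .condFalse (by simp [State.reg_setReg, hy]) (.const _ _ _), by omega,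
        (((Frame.refl d s).setReg (by omega)).setReg (by omega)).setReg (by omega), ?_⟩
      simp [State.reg_setReg, hy]
    · obtain ⟨t, s', h1, h2, h3⟩ : Run (.seq (.add (d + 4) d (d + 3))
          (.seq (.sub (d + 4) (d + 4) (d + 1))
          (.loop (d + 4) (.seq (.sub d d (d + 1)) (.seq (.add (d + 2) (d + 2) (d + 3))
          (.seq (.add (d + 4) d (d + 3)) (.sub (d + 4) (d + 4) (d + 1))))))))
          ((s.setReg (d + 2) 0).setReg (d + 3) 1)
          (1 + (1 + ((s.reg d / s.reg (d + 1)) * (4 + 1) + 1))) (fun s' => Frame d s s' ∧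
            s'.reg (d + 2) = s.reg d / s.reg (d + 1)) := by
        refine Run.step (.add _ _ _ _) (Run.step (.sub _ _ _ _) ?_)
        refine (Run.loop (I := fun i s' => Frame d s s' ∧ s'.reg d = s.reg d - i * s.reg (d + 1) ∧
          s'.reg (d + 1) = s.reg (d + 1) ∧ s'.reg (d + 2) = i ∧ s'.reg (d + 3) = 1 ∧
          s'.reg (d + 4) = s.reg d - i * s.reg (d + 1) + 1 - s.reg (d + 1))
          ?_ ?_ ?_).mono le_rfl ?_
        · rintro i hi s' ⟨-, -, -, -, -, h1⟩
          have h2 := (Nat.le_div_iff_mul_le (Nat.pos_of_ne_zero hy)).1 hi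
          have h3 := (Nat.le_div_iff_mul_le (x := i + 1) (y := s.reg d) (Nat.pos_of_ne_zero hy))
          rw [Nat.add_mul] at h3
          omega
        · rintro i hi s' ⟨hF, h1, h2, h3, h4, h5⟩
          refine Run.step (.sub _ _ _ _) (Run.step (.add _ _ _ _) (Run.step (.add _ _ _ _)
            (.of_exec (.sub _ _ _ _) ⟨(((hF.setReg le_rfl).setReg (by omega)).setReg
              (by omega)).setReg (by omega), ?_⟩)))
          simp [State.reg_setReg, h1, h2, h3, h4, Nat.add_mul]
          omega
        · exact ⟨((((Frame.refl d s).setReg (by omega)).setReg (by omega)).setReg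
            (by omega)).setReg (by omega), by simp [State.reg_setReg]⟩
        · rintro s' ⟨hF, -, -, h2, -⟩
          exact ⟨hF, h2⟩
      exact ⟨_, s', .condTrue (by simp [State.reg_setReg, hy]) h1, by omega, h3⟩
  · rintro s' ⟨hF, h1⟩
    exact .step (.const _ _ _) (.of_exec (.add _ _ _ _)
      ⟨(hF.setReg le_rfl).setReg le_rfl, by simp [State.reg_setReg, h1]⟩)

namespace Evaluable

variable {f g : ℕ → ℕ → ℕ → (ℕ → ℕ) → ℕ}

theorem add (hf : Evaluable f) (hg : Evaluable g) :
    Evaluable fun n u v m => f n u v m + g n u v m := evaluableOp_add.comp hf hg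

theorem sub (hf : Evaluable f) (hg : Evaluable g) :
    Evaluable fun n u v m => f n u v m - g n u v m := evaluableOp_sub.comp hf hg

theorem mul (hf : Evaluable f) (hg : Evaluable g) :
    Evaluable fun n u v m => f n u v m * g n u v m := evaluableOp_mul.comp hf hg

theorem div (hf : Evaluable f) (hg : Evaluable g) :
    Evaluable fun n u v m => f n u v m / g n u v m := evaluableOp_div.comp hf hg

theorem mod (hf : Evaluable f) (hg : Evaluable g) :
    Evaluable fun n u v m => f n u v m % g n u v m := by
  simpa only [Nat.mod_eq_sub] using hf.sub (hg.mul (hf.div hg))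

theorem const (c : ℕ) : Evaluable fun _ _ _ _ => c := by
  refine fun d hd => ⟨.const d c, Polynomial.C (c + 1), fun s B hs hm => ?_⟩
  rw [Polynomial.eval_C]
  exact ⟨Nat.le_succ c, (Run.of_exec (.const d c s)
    ⟨(Frame.refl d s).setReg le_rfl, by simp [State.reg_setReg]⟩).mono (by omega) fun _ => id⟩

theorem of_reg (x : ℕ) (hx : x < 3)
    (h : ∀ s : State, f (s.reg 0) (s.reg 1) (s.reg 2) s.mem = s.reg x) : Evaluable f := by
  refine fun d hd => ⟨.seq (.const d 0) (.add d d x), Polynomial.X + 2, fun s B hs hm => ?_⟩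
  have hB : Polynomial.eval B (Polynomial.X + 2) = B + 2 := by simp
  rw [hB, h s]
  exact ⟨(hs x hx).trans (by omega), (Run.step (.const d 0 s) (.of_exec (.add d d x _)
    ⟨((Frame.refl d s).setReg le_rfl).setReg le_rfl, by
      simp [State.reg_setReg, show x ≠ d by omega]⟩)).mono (by omega) fun _ => id⟩

theorem reg₀ : Evaluable fun n _ _ _ => n := of_reg 0 (by omega) fun _ => rfl

theorem reg₁ : Evaluable fun _ u _ _ => u := of_reg 1 (by omega) fun _ => rfl

theorem reg₂ : Evaluable fun _ _ v _ => v := of_reg 2 (by omega) fun _ => rfl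

theorem load (hf : Evaluable f) : Evaluable fun n u v m => m (f n u v m) := by
  intro d hd
  obtain ⟨P, p, H⟩ := hf d hd
  refine ⟨.seq P (.load d d), p + (Polynomial.X + 1), fun s B hs hm => ?_⟩
  simp only [Polynomial.eval_add, Polynomial.eval_X, Polynomial.eval_one]
  refine ⟨(hm _).trans (by omega), Run.mono ((H s B hs hm).2.seq fun s' h =>
    Run.of_exec (.load d d s') (Q := fun s' => Frame d s s' ∧
      s'.reg d = s.mem (f (s.reg 0) (s.reg 1) (s.reg 2) s.mem))
      ⟨h.1.setReg le_rfl, ?_⟩) (by omega) fun _ => id⟩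
  simp [State.reg_setReg, h.2, h.1.mem]

end Evaluable

open Classical in
/-- A property of the registers `0`, `1`, `2` and of the memory that can be decided in
polynomial time. -/
def Testable (φ : ℕ → ℕ → ℕ → (ℕ → ℕ) → Prop) : Prop :=
  Evaluable fun n u v m => if φ n u v m then 1 else 0

namespace Testable

variable {φ ψ : ℕ → ℕ → ℕ → (ℕ → ℕ) → Prop} {f g : ℕ → ℕ → ℕ → (ℕ → ℕ) → ℕ}

theorem of_evaluable (hf : Evaluable f) : Testable fun n u v m => f n u v m ≠ 0 := by
  unfold Testable
  convert (Evaluable.const 1).sub ((Evaluable.const 1).sub hf) using 5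
  split_ifs <;> omega

theorem const (c : Prop) : Testable fun _ _ _ _ => c := by
  by_cases h : c <;> simpa [Testable, h] using Evaluable.const _

theorem not (h : Testable φ) : Testable fun n u v m => ¬ φ n u v m := by
  unfold Testable
  convert (Evaluable.const 1).sub h using 5
  split_ifs <;> simp_all

theorem and (h : Testable φ) (h' : Testable ψ) :
    Testable fun n u v m => φ n u v m ∧ ψ n u v m := by
  unfold Testable
  convert Evaluable.mul h h' using 5
  split_ifs <;> simp_all

theorem or (h : Testable φ) (h' : Testable ψ) :
    Testable fun n u v m => φ n u v m ∨ ψ n u v m := by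
  simpa only [not_and_or, not_not] using (h.not.and h'.not).not

theorem imp (h : Testable φ) (h' : Testable ψ) :
    Testable fun n u v m => φ n u v m → ψ n u v m := by
  simpa only [imp_iff_not_or] using h.not.or h'

theorem lt (hf : Evaluable f) (hg : Evaluable g) :
    Testable fun n u v m => f n u v m < g n u v m := by
  simpa only [ne_eq, Nat.sub_eq_zero_iff_le, not_le] using of_evaluable (hg.sub hf)

theorem eq (hf : Evaluable f) (hg : Evaluable g) :
    Testable fun n u v m => f n u v m = g n u v m := by
  simpa only [not_lt, ← le_antisymm_iff] using (lt hg hf).not.and (lt hf hg).not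

theorem exists_fin {N : ℕ} {φ : Fin N → ℕ → ℕ → ℕ → (ℕ → ℕ) → Prop} (h : ∀ i, Testable (φ i)) :
    Testable fun n u v m => ∃ i, φ i n u v m := by
  induction N with
  | zero => simpa using const False
  | succ N ih => simpa only [Fin.exists_fin_succ] using (h 0).or (ih fun i => h i.succ)

theorem forall_fin {N : ℕ} {φ : Fin N → ℕ → ℕ → ℕ → (ℕ → ℕ) → Prop} (h : ∀ i, Testable (φ i)) :
    Testable fun n u v m => ∀ i, φ i n u v m := by
  simpa only [not_exists, not_not] using (exists_fin fun i => (h i).not).not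

end Testable

end RAM

/-! ## Printing an adjacency matrix -/

theorem adjWord_eq_range {n : ℕ} (G : SimpleGraph (Fin n)) (b : ℕ → ℕ → ℕ)
    (hb : ∀ u v : Fin n, [G.Adj u v] = [b u v = 1]) (hb' : ∀ u v, b u v = 0 ∨ b u v = 1) :
    adjWord G = (List.range n).flatMap fun u => (List.range n).map fun v => b u v := by
  classical
  rw [← List.map_coe_finRange_eq_range, adjWord]
  simp only [List.flatMap_map, List.map_map]
  congr 1
  funext u
  congr 1
  funext v
  have h : G.Adj u v ↔ b u v = 1 := by simpa using hb u v
  rcases hb' u v with h' | h' <;> simp [h, h']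

theorem length_adjWord {n : ℕ} (G : SimpleGraph (Fin n)) : (adjWord G).length = n * n := by
  simp [adjWord, List.length_flatMap]

theorem getD_flatMap_of_length {α : Type*} (l : List α) (f : α → List ℕ) (n : ℕ)
    (hf : ∀ a, (f a).length = n) (i j : ℕ) (hi : i < l.length) (hj : j < n) :
    (l.flatMap f).getD (i * n + j) 0 = (f l[i]).getD j 0 := by
  induction l generalizing i with
  | nil => simp at hi
  | cons a l ih =>
    rw [List.flatMap_cons]
    cases i with
    | zero => rw [List.getD_append _ _ _ _ (by rw [hf]; omega)]; simp
    | succ i =>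
      rw [List.getD_append_right _ _ _ _ (by rw [hf, Nat.add_mul]; omega), hf,
        show (i + 1) * n + j - n = i * n + j by rw [Nat.add_mul]; omega,
        ih i (by simpa using hi)]
      simp

open Classical in
theorem getD_adjWord {n : ℕ} (G : SimpleGraph (Fin n)) (u v : Fin n) :
    (adjWord G).getD (u * n + v) 0 = if G.Adj u v then 1 else 0 := by
  rw [adjWord, getD_flatMap_of_length _ _ n (by simp) _ _ (by simp) v.2]
  simp [List.getD_eq_getElem?_getD]

theorem mem_adjWord {n : ℕ} (G : SimpleGraph (Fin n)) : ∀ a ∈ adjWord G, a ≤ 1 := by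
  intro a ha
  simp only [adjWord, List.mem_flatMap, List.mem_map] at ha
  obtain ⟨u, -, v, -, rfl⟩ := ha
  split_ifs <;> omega

theorem le_wordSize_encode (I : GraphInstance) : I.n ≤ RAM.wordSize I.encode := by
  have h : ∀ w : List ℕ, w.length ≤ RAM.wordSize w := by
    intro w
    induction w with
    | nil => simp
    | cons a w ih =>
      simp only [RAM.wordSize, List.map_cons, List.sum_cons, List.length_cons] at ih ⊢
      omega
  refine le_trans ?_ (h _)
  simp only [GraphInstance.encode, List.length_cons, length_adjWord]
  nlinarith [Nat.le_mul_self I.n]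

namespace RAM

/-- Read `N` numbers, where `N` is the content of register `4`, into the memory. -/
theorem run_readLoop (w : List ℕ) (s : State) (h1 : s.input = w) (h2 : s.reg 4 = w.length)
    (h3 : s.mem = fun _ => 0) (h5 : s.reg 5 = 0) (h6 : s.reg 6 = 1) :
    Run (.loop 4 (.seq (.read 7) (.seq (.store 5 7) (.seq (.add 5 5 6) (.sub 4 4 6))))) s
      (w.length * 5 + 1) fun s' => s'.mem = (fun a => w.getD a 0) ∧ s'.output = s.output ∧
        ∀ x < 4, s'.reg x = s.reg x := by
  refine (Run.loop (I := fun i s' => s'.mem = (fun a => if a < i then w.getD a 0 else 0) ∧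
    s'.input = w.drop i ∧ s'.reg 4 = w.length - i ∧ s'.reg 5 = i ∧ s'.reg 6 = 1 ∧
    s'.output = s.output ∧ ∀ x < 4, s'.reg x = s.reg x) ?_ ?_ ?_).mono le_rfl ?_
  · rintro i hi s' ⟨-, -, h, -⟩
    omega
  · rintro i hi s' ⟨hm, hi, h4, h5, h6, ho, hr⟩
    refine Run.step (.read _ _) (Run.step (.store _ _ _) (Run.step (.add _ _ _ _)
      (.of_exec (.sub _ _ _ _) ⟨?_, ?_, ?_, ?_, ?_, ?_, ?_⟩)))
    · funext a
      simp only [State.setReg, Function.update_apply, hm, hi, h5]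
      simp only [Nat.reduceEqDiff, ↓reduceIte, List.headD_eq_head?_getD,
        List.head?_drop, List.getD_eq_getElem?_getD]
      split_ifs <;> first | omega | simp_all
    · simp [State.setReg, hi]
    · simp [State.setReg, h4, h6]
      omega
    · simp [State.setReg, h5, h6]
    · simp [State.setReg, h6]
    · simp [State.setReg, ho]
    · intro x hx
      simp [State.setReg, show x ≠ 7 by omega, show x ≠ 5 by omega,
        show x ≠ 4 by omega, hr x hx]
  · exact ⟨by simp [h3], by simp [h1], by simp [h2], h5, h6, rfl, fun _ _ => rfl⟩
  · rintro s' ⟨hm, -, -, -, -, ho, hr⟩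
    refine ⟨?_, ho, hr⟩
    rw [hm]
    funext a
    split_ifs with h
    · rfl
    · rw [List.getD_eq_default _ _ (by omega)]

/-- Print one row of the matrix `f`. -/
theorem run_rowLoop {f : ℕ → ℕ → ℕ → (ℕ → ℕ) → ℕ} {P : Prog} {T n u N : ℕ} {m : ℕ → ℕ}
    (hP : ∀ v < N, ∀ s : State, s.reg 0 = n → s.reg 1 = u → s.reg 2 = v → s.mem = m →
      Run P s T fun s' => Frame 8 s s' ∧ s'.reg 8 = f n u v m)
    (s : State) (h0 : s.reg 0 = n) (h1 : s.reg 1 = u) (h2 : s.reg 2 = 0) (h5 : s.reg 5 = N)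
    (h6 : s.reg 6 = 1) (hm : s.mem = m) :
    Run (.loop 5 (.seq P (.seq (.print 8) (.seq (.add 2 2 6) (.sub 5 5 6))))) s
      (N * (T + 4) + 1) fun s' => s'.mem = m ∧
        s'.output = s.output ++ (List.range N).map (fun v => f n u v m) ∧
        ∀ x < 8, x ≠ 2 → x ≠ 5 → s'.reg x = s.reg x := by
  refine (Run.loop (T := T + 3) (I := fun i s' => s'.mem = m ∧
    s'.output = s.output ++ (List.range i).map (fun v => f n u v m) ∧ s'.reg 2 = i ∧
    s'.reg 5 = N - i ∧ ∀ x < 8, x ≠ 2 → x ≠ 5 → s'.reg x = s.reg x) ?_ ?_ ?_).mono le_rfl ?_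
  · rintro i hi s' ⟨-, -, -, h, -⟩
    omega
  · rintro i hi s' ⟨hm', ho, hi2, hi5, hr⟩
    refine (hP i hi s' ((hr 0 (by omega) (by omega) (by omega)).trans h0)
      ((hr 1 (by omega) (by omega) (by omega)).trans h1) hi2 hm').seq ?_
    rintro s'' ⟨hF, h8⟩
    have e2 := hF.reg 2 (by omega)
    have e5 := hF.reg 5 (by omega)
    have e6 := (hF.reg 6 (by omega)).trans ((hr 6 (by omega) (by omega) (by omega)).trans h6)
    refine Run.step (.print _ _) (Run.step (.add _ _ _ _) (.of_exec (.sub _ _ _ _)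
      ⟨?_, ?_, ?_, ?_, ?_⟩))
    · simp [State.setReg, hF.mem, hm']
    · simp [State.setReg, hF.output, ho, List.range_succ, h8]
    · simp [State.setReg, e2, e6, hi2]
    · simp [State.setReg, e5, e6, hi5]
      omega
    · intro x hx hx2 hx5
      simp [State.setReg, hx2, hx5, hF.reg x hx, hr x hx hx2 hx5]
  · exact ⟨hm, by simp, h2, by omega, fun _ _ _ _ => rfl⟩
  · rintro s' ⟨hm', ho, -, -, hr⟩
    exact ⟨hm', ho, hr⟩

/-- Print the matrix `f`. -/
theorem run_matrixLoop {f : ℕ → ℕ → ℕ → (ℕ → ℕ) → ℕ} {P : Prog} {T n N : ℕ} {m : ℕ → ℕ}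
    (hP : ∀ u < N, ∀ v < N, ∀ s : State, s.reg 0 = n → s.reg 1 = u → s.reg 2 = v → s.mem = m →
      Run P s T fun s' => Frame 8 s s' ∧ s'.reg 8 = f n u v m)
    (s : State) (h0 : s.reg 0 = n) (h1 : s.reg 1 = 0) (h3 : s.reg 3 = N) (h4 : s.reg 4 = N)
    (h6 : s.reg 6 = 1) (h7 : s.reg 7 = 0) (hm : s.mem = m) :
    Run (.loop 3 (.seq (.const 2 0) (.seq (.add 5 4 7) (.seq
      (.loop 5 (.seq P (.seq (.print 8) (.seq (.add 2 2 6) (.sub 5 5 6)))))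
      (.seq (.add 1 1 6) (.sub 3 3 6)))))) s
      (N * (N * (T + 4) + 6) + 1) fun s' =>
        s'.output = s.output ++
          (List.range N).flatMap fun u => (List.range N).map fun v => f n u v m := by
  refine (Run.loop (T := 1 + (1 + ((N * (T + 4) + 1) + (1 + 1)))) (I := fun i s' => s'.mem = m ∧
    (s'.output = s.output ++
      (List.range i).flatMap fun u => (List.range N).map fun v => f n u v m) ∧ s'.reg 0 = n ∧
    s'.reg 1 = i ∧ s'.reg 3 = N - i ∧ s'.reg 4 = N ∧ s'.reg 6 = 1 ∧ s'.reg 7 = 0)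
    ?_ ?_ ?_).mono (Nat.le_of_eq (by ring)) ?_
  · rintro i hi s' ⟨-, -, -, -, h, -⟩
    omega
  · rintro i hi s' ⟨hm', ho, h0, h1, h3, h4, h6, h7⟩
    refine Run.step (.const _ _ _) (Run.step (.add _ _ _ _)
      (Run.seq (run_rowLoop (hP i hi) _ ?_ ?_ ?_ ?_ ?_ ?_) ?_))
    · simp [State.reg_setReg, h0]
    · simp [State.reg_setReg, h1]
    · simp [State.reg_setReg]
    · simp [State.reg_setReg, h4, h7]
    · simp [State.reg_setReg, h6]
    · simp [State.setReg, hm']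
    · rintro s'' ⟨hm'', ho', hr⟩
      simp only [State.reg_setReg] at hr
      have e0 := hr 0 (by omega) (by omega) (by omega)
      have e1 := hr 1 (by omega) (by omega) (by omega)
      have e3 := hr 3 (by omega) (by omega) (by omega)
      have e4 := hr 4 (by omega) (by omega) (by omega)
      have e6 := hr 6 (by omega) (by omega) (by omega)
      have e7 := hr 7 (by omega) (by omega) (by omega)
      norm_num at e0 e1 e3 e4 e6 e7
      refine Run.step (.add _ _ _ _) (.of_exec (.sub _ _ _ _) ⟨hm'', ?_, ?_⟩)
      · simp [State.setReg, ho', ho, List.range_succ]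
      · simp [State.reg_setReg, e0, e1, e3, e4, e6, e7, h0, h1, h3, h4, h6, h7]
        omega
  · exact ⟨hm, by simp, h0, h1, by omega, h4, h6, h7⟩
  · rintro s' ⟨-, ho, -⟩
    exact ho

end RAM

open RAM in
theorem GraphInstance.polyTimeComputable {g : ℕ → ℕ} (hg : Evaluable fun n _ _ _ => g n)
    {φ : ℕ → ℕ → ℕ → (ℕ → ℕ) → Prop} (hφ : Testable φ) (F : GraphInstance → GraphInstance)
    (hk : ∀ I, (F I).k = min I.k (I.n * I.n)) (hn : ∀ I, (F I).n = g I.n)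
    (hadj : ∀ I (u v : Fin (F I).n), (F I).G.Adj u v ↔
      φ I.n u v fun a => (adjWord I.G).getD a 0) :
    PolyTimeComputable GraphInstance.encode GraphInstance.encode F := by
  classical
  obtain ⟨P₁, p₁, H₁⟩ := (Evaluable.reg₀.mul Evaluable.reg₀) 4 (by omega)
  obtain ⟨P₂, p₂, H₂⟩ := hg 4 (by omega)
  obtain ⟨P₃, p₃, H₃⟩ := hφ 8 (by omega)
  let B : Polynomial ℕ := p₂.comp (Polynomial.X + 1) + (Polynomial.X + 1)
  refine ⟨.seq (.read 3) <| .seq (.read 0) <| .seq P₁ <| .seq (.sub 5 3 4) <| .seq (.sub 6 3 5) <|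
    .seq (.print 6) <| .seq (.const 5 0) <| .seq (.const 6 1) <| .seq
    (.loop 4 (.seq (.read 7) (.seq (.store 5 7) (.seq (.add 5 5 6) (.sub 4 4 6))))) <|
    .seq P₂ <| .seq (.print 4) <| .seq (.const 7 0) <| .seq (.const 6 1) <| .seq (.const 1 0) <|
    .seq (.add 3 4 7) <|
    .loop 3 (.seq (.const 2 0) (.seq (.add 5 4 7) (.seq
      (.loop 5 (.seq P₃ (.seq (.print 8) (.seq (.add 2 2 6) (.sub 5 5 6)))))
      (.seq (.add 1 1 6) (.sub 3 3 6))))),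
    1 + (1 + (p₁.comp (Polynomial.X + 1) + (1 + (1 + (1 + (1 + (1 +
      ((Polynomial.X * Polynomial.X * 5 + 1) +
      (p₂.comp (Polynomial.X + 1) + (1 + (1 + (1 + (1 + (1 +
      ((B * (B * (p₃.comp B + 4) + 6) + 1)))))))))))))))), fun I => ?_⟩
  suffices H : Run _ (State.init I.encode) _ fun s => s.output = (F I).encode by
    obtain ⟨t, s, h1, h2, h3⟩ := H.mono (eval_le_eval _ (le_wordSize_encode I)) fun _ => id
    exact ⟨t, s, h1, h2, h3⟩
  set n := I.n with hn'
  set w := adjWord I.G with hw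
  have hlen : w.length = n * n := length_adjWord I.G
  have hB : B.eval n = p₂.eval (n + 1) + (n + 1) := by simp [B]
  have hwle : ∀ a, w.getD a 0 ≤ 1 := by
    intro a
    rw [List.getD_eq_getElem?_getD]
    rcases h : w[a]? with _ | b
    · simp
    · exact mem_adjWord I.G b (List.mem_of_getElem? h)
  simp only [Polynomial.eval_add, Polynomial.eval_mul, Polynomial.eval_comp, Polynomial.eval_X,
    Polynomial.eval_one, Polynomial.eval_ofNat, hB]
  refine Run.step (.read _ _) (Run.step (.read _ _) (Run.seq (Q := fun s => s.reg 0 = n ∧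
    s.reg 1 = 0 ∧ s.reg 2 = 0 ∧ s.reg 3 = I.k ∧ s.reg 4 = n * n ∧ s.mem = (fun _ => 0) ∧
    s.input = w ∧ s.output = []) ?_ ?_))
  · obtain ⟨-, h⟩ := H₁ { ({ (State.init I.encode).setReg 3 I.k with
      input := n :: w } : State).setReg 0 n with input := w } (n + 1) (fun x hx => by
        interval_cases x <;> simp [State.setReg, State.init]) (fun a => by
        simp [State.setReg, State.init])
    refine h.mono le_rfl fun s' ⟨hF, e⟩ => ?_
    have e0 := hF.reg 0 (by omega)
    have e1 := hF.reg 1 (by omega)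
    have e2 := hF.reg 2 (by omega)
    have e3 := hF.reg 3 (by omega)
    have em := hF.mem
    have ei := hF.input
    have eo := hF.output
    simp [State.setReg, State.init] at e0 e1 e2 e3 e em ei eo
    exact ⟨e0, e1, e2, e3, e, em, ei, eo⟩
  rintro s ⟨h0, h1, h2, h3, h4, hm, hi, ho⟩
  refine Run.step (.sub _ _ _ _) (Run.step (.sub _ _ _ _) (Run.step (.print _ _)
    (Run.step (.const _ _ _) (Run.step (.const _ _ _) ((Run.seq (Q := fun s =>
      s.mem = (fun a => w.getD a 0) ∧ s.output = [(F I).k] ∧ s.reg 0 = n ∧ s.reg 1 = 0 ∧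
      s.reg 2 = 0) ?_ ?_))))))
  · refine (run_readLoop w _ ?_ ?_ ?_ ?_ ?_).mono (by rw [hlen]) ?_
    · simp [State.setReg, hi]
    · simp [State.setReg, h4, hlen]
    · simp [State.setReg, hm]
    · simp [State.setReg]
    · simp [State.setReg]
    · rintro s' ⟨hm', ho', hr⟩
      have e0 := hr 0 (by omega)
      have e1 := hr 1 (by omega)
      have e2 := hr 2 (by omega)
      simp [State.setReg] at e0 e1 e2 ho'
      refine ⟨hm', ?_, e0.trans h0, e1.trans h1, e2.trans h2⟩
      rw [ho', ho, h3, h4, hk, ← hn']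
      simp only [List.nil_append, List.cons.injEq, and_true]
      omega
  clear h0 h1 h2 h3 h4 hm hi ho s
  rintro s ⟨hm, ho, h0, h1, h2⟩
  obtain ⟨hgB, h⟩ := H₂ s (n + 1) (fun x hx => by interval_cases x <;> omega)
    (fun a => by rw [hm]; exact (hwle a).trans (by omega))
  rw [h0] at hgB h
  dsimp only at hgB h
  refine h.seq fun s' ⟨hF, h4⟩ => ?_
  refine Run.step (.print _ _) (Run.step (.const _ _ _) (Run.step (.const _ _ _)
    (Run.step (.const _ _ _) (Run.step (.add _ _ _ _) ?_))))
  refine Run.mono (T := g n * (g n * (p₃.eval (p₂.eval (n + 1) + (n + 1)) + 4) + 6) + 1)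
    (run_matrixLoop (n := n) (m := fun a => w.getD a 0)
      (f := fun n u v m => if φ n u v m then 1 else 0) ?_ _ ?_ ?_ ?_ ?_ ?_ ?_ ?_) ?_ ?_
  · intro u hu v hv s'' e0 e1 e2 em
    obtain ⟨-, h⟩ := H₃ s'' (p₂.eval (n + 1) + (n + 1)) (fun x hx => by
      interval_cases x <;> omega) (fun a => by rw [em]; exact (hwle a).trans (by omega))
    rw [e0, e1, e2, em] at h
    exact h
  · simp [State.setReg, hF.reg 0, h0]
  · simp [State.setReg]
  · simp [State.setReg, h4]
  · simp [State.setReg, h4]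
  · simp [State.setReg]
  · simp [State.setReg]
  · simp [State.setReg, hF.mem, hm]
  · have : g n ≤ p₂.eval (n + 1) + (n + 1) := by omega
    gcongr
  · intro s'' e
    rw [e, GraphInstance.encode, adjWord_eq_range (F I).G
      (fun u v => if φ n u v (fun a => w.getD a 0) then 1 else 0) ?_ ?_, hn, ← hn']
    · simp [State.setReg, hF.output, ho, h4]
    · intro u v
      simp [hadj I u v, hn', hw]
    · intro u v
      split_ifs <;> simp

/-! ## The gadget graph -/

section Gadget

variable {X T Q : Type*}

/-- The index `t` of a gadget describes a copy of the first part of `R` in `G`, as a subgraph that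
need not be induced. -/
def GadgetValid (G : SimpleGraph X) (R : SimpleGraph (Fin 3 ⊕ Q)) (p : T → Fin 3 → X) (t : T) :
    Prop :=
  (∀ i j, p t i = p t j → i = j) ∧ ∀ i j, R.Adj (.inl i) (.inl j) → G.Adj (p t i) (p t j)

/-- To `G` is added, for every index `t` of a copy of the first part of `R`, the second part
of `R`, joined to the copy as in `R`. -/
def gadgetGraph (G : SimpleGraph X) (R : SimpleGraph (Fin 3 ⊕ Q)) (p : T → Fin 3 → X) :
    SimpleGraph (X ⊕ T × Q) where
  Adj
    | .inl x, .inl y => G.Adj x y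
    | .inl x, .inr (t, w) => GadgetValid G R p t ∧ ∃ i, p t i = x ∧ R.Adj (.inl i) (.inr w)
    | .inr (t, w), .inl x => GadgetValid G R p t ∧ ∃ i, p t i = x ∧ R.Adj (.inl i) (.inr w)
    | .inr (t, w), .inr (t', w') => GadgetValid G R p t ∧ t = t' ∧ R.Adj (.inr w) (.inr w')
  symm := ⟨by
    rintro (x | ⟨t, w⟩) (y | ⟨t', w'⟩) h
    · exact SimpleGraph.Adj.symm h
    · exact h
    · exact h
    · obtain ⟨h1, rfl, h2⟩ := h
      exact ⟨h1, rfl, h2.symm⟩⟩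
  loopless := ⟨by
    rintro (x | ⟨t, w⟩) h
    · exact G.irrefl h
    · exact R.irrefl h.2.2⟩

/-- The vertex of the gadget `t` that corresponds to a vertex of `R`. -/
def gadgetVertex (p : T → Fin 3 → X) (t : T) : Fin 3 ⊕ Q → X ⊕ T × Q :=
  Sum.map (p t) (Prod.mk t)

variable {G : SimpleGraph X} {R : SimpleGraph (Fin 3 ⊕ Q)} {p : T → Fin 3 → X} {t : T}

theorem GadgetValid.injective (h : GadgetValid G R p t) :
    Function.Injective (gadgetVertex p t : Fin 3 ⊕ Q → X ⊕ T × Q) :=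
  Function.Injective.sumMap (fun _ _ => h.1 _ _) fun _ _ e => (Prod.ext_iff.1 e).2

theorem gadgetGraph_adj_inr {w : Q} {z : X ⊕ T × Q} :
    (gadgetGraph G R p).Adj (.inr (t, w)) z ↔
      GadgetValid G R p t ∧ ∃ v, R.Adj (.inr w) v ∧ gadgetVertex p t v = z := by
  rcases z with x | ⟨t', w'⟩
  · simp [gadgetGraph, gadgetVertex, R.adj_comm, and_comm]
  · simp [gadgetGraph, gadgetVertex]
    tauto

/-- `H`-free Edge Deletion for a graph on an arbitrary type. -/
def EdgeDeletable {V X : Type*} (H : SimpleGraph V) (G : SimpleGraph X) (k : ℕ) : Prop :=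
  ∃ F : Finset (Sym2 X), (F : Set (Sym2 X)) ⊆ G.edgeSet ∧ F.card ≤ k ∧
    ¬ H.IsIndContained (G.deleteEdges F)

theorem EdgeDeletable.of_iso {V V' X X' : Type*} {H : SimpleGraph V} {H' : SimpleGraph V'}
    {G : SimpleGraph X} {G' : SimpleGraph X'} {k : ℕ} (h : EdgeDeletable H G k) (e : H ≃g H')
    (f : G ≃g G') : EdgeDeletable H' G' k := by
  obtain ⟨F, hF, hk, hH⟩ := h
  refine ⟨F.map (Function.Embedding.sym2Map f.toEquiv.toEmbedding), ?_, by simpa using hk, ?_⟩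
  · intro a ha
    simp only [Finset.coe_map, Set.mem_image, Finset.mem_coe] at ha
    obtain ⟨b, hb, rfl⟩ := ha
    have := hF hb
    induction b with
    | _ x y => exact f.map_adj_iff.2 this
  · rintro ⟨g⟩
    refine hH ⟨⟨(e.toEquiv.toEmbedding.trans g.toEmbedding).trans f.symm.toEquiv.toEmbedding, ?_⟩⟩
    intro a b
    have h1 := g.map_rel_iff (a := e a) (b := e b)
    rw [e.map_adj_iff] at h1
    rw [← h1]
    have h2 : ∀ x y : X', s(x, y) ∈ F.map (Function.Embedding.sym2Map f.toEquiv.toEmbedding) ↔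
        s(f.symm x, f.symm y) ∈ F := by
      intro x y
      rw [← Finset.mem_map' (Function.Embedding.sym2Map f.toEquiv.toEmbedding)]
      simp
    simp only [SimpleGraph.deleteEdges_adj, Finset.mem_coe]
    have h3 := h2 (g (e a)) (g (e b))
    have h4 := f.symm.map_adj_iff (v := g (e a)) (w := g (e b))
    exact and_congr h4 (not_congr h3.symm)

theorem EdgeDeletable.of_gadgetGraph [Fintype T] [DecidableEq T] [DecidableEq X] {k : ℕ}
    (hp : ∀ c : Fin 3 → X, k < (Finset.univ.filter fun t => p t = c).card)
    (h : EdgeDeletable R (gadgetGraph G R p) k) : EdgeDeletable (R.comap Sum.inl) G k := by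
  classical
  obtain ⟨F, hF, hk, hR⟩ := h
  let ι : Sym2 X ↪ Sym2 (X ⊕ T × Q) := Function.Embedding.sym2Map ⟨Sum.inl, Sum.inl_injective⟩
  have hι : ∀ x y, ι s(x, y) = s(.inl x, .inl y) := fun _ _ => rfl
  refine ⟨F.preimage ι ι.injective.injOn, ?_, ?_, ?_⟩
  · intro a ha
    simp only [Finset.coe_preimage, Set.mem_preimage, Finset.mem_coe] at ha
    have := hF ha
    induction a with
    | _ x y => exact this
  · exact (Finset.card_le_card_of_injOn ι (fun a ha => by simpa using ha) ι.injective.injOn).trans hk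
  rintro ⟨φ⟩
  have hφ : ∀ i j, R.Adj (.inl i) (.inl j) ↔
      G.Adj (φ i) (φ j) ∧ s(.inl (φ i), .inl (φ j)) ∉ F := by
    intro i j
    have h1 := φ.map_adj_iff (v := i) (w := j)
    simpa [hι, eq_comm, iff_comm] using h1
  have hval : ∀ t, p t = φ → GadgetValid G R p t := by
    intro t ht
    refine ⟨fun i j hij => φ.injective (by rwa [ht] at hij), fun i j hij => ?_⟩
    rw [ht]
    exact ((hφ i j).1 hij).1
  obtain ⟨t, ht, hfree⟩ : ∃ t, p t = φ ∧ ∀ w z, s(.inr (t, w), z) ∉ F := by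
    by_contra! hcon
    have h1 : ∀ t ∈ Finset.univ.filter (fun t => p t = φ), ∃ e ∈ F, ∃ w, .inr (t, w) ∈ e := by
      intro t ht
      obtain ⟨w, z, hwz⟩ := hcon t (by simpa using ht)
      exact ⟨_, hwz, w, by simp⟩
    obtain ⟨t₀, ht₀⟩ := Finset.card_pos.1 ((Nat.zero_le k).trans_lt (hp φ))
    obtain ⟨w₀, z₀, -⟩ := hcon t₀ (by simpa using ht₀)
    have : Nonempty Q := ⟨w₀⟩
    have : Nonempty (Sym2 (X ⊕ T × Q)) := ⟨s(z₀, z₀)⟩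
    choose! e he we hwe using h1
    refine absurd (hp φ) (not_lt.2 ((Finset.card_le_card_of_injOn e he ?_).trans hk))
    intro t ht t' ht' heq
    by_contra hne
    have h1 := hwe t ht
    have h2 := hwe t' ht'
    rw [← heq] at h2
    have h3 : e t = s(.inr (t, we t), .inr (t', we t')) :=
      (Sym2.mem_and_mem_iff (by simp [hne])).1 ⟨h1, h2⟩
    have h4 := hF (he t ht)
    rw [h3] at h4
    exact hne h4.2.1
  refine hR ⟨⟨⟨gadgetVertex p t, (hval t ht).injective⟩, ?_⟩⟩
  rintro (i | w) (j | w')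
  · simp [gadgetVertex, hφ, ht, gadgetGraph]
  · have h1 := hfree w' (.inl (p t i))
    rw [Sym2.eq_swap] at h1
    simp only [gadgetVertex, Function.Embedding.coeFn_mk, Sum.map_inl, Sum.map_inr,
      SimpleGraph.deleteEdges_adj, Finset.mem_coe, h1, not_false_eq_true, and_true]
    refine ⟨fun ⟨_, j, h2, h3⟩ => ?_, fun h => ⟨hval t ht, i, rfl, h⟩⟩
    rwa [← (hval t ht).1 _ _ h2]
  · have h1 := hfree w (.inl (p t j))
    simp only [gadgetVertex, Function.Embedding.coeFn_mk, Sum.map_inl, Sum.map_inr,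
      SimpleGraph.deleteEdges_adj, Finset.mem_coe, h1, not_false_eq_true, and_true]
    refine ⟨fun ⟨_, i, h2, h3⟩ => ?_, fun h => ⟨hval t ht, j, rfl, h.symm⟩⟩
    rw [← (hval t ht).1 _ _ h2]
    exact h3.symm
  · simp only [gadgetVertex, Function.Embedding.coeFn_mk, Sum.map_inr,
      SimpleGraph.deleteEdges_adj, Finset.mem_coe, hfree, not_false_eq_true, and_true]
    exact ⟨fun h => h.2.2, fun h => ⟨hval t ht, rfl, h⟩⟩

/-- A graph on three vertices is determined by the degrees of its vertices. -/
theorem SimpleGraph.eq_of_degree_eq_fin_three (A B : SimpleGraph (Fin 3)) [DecidableRel A.Adj]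
    [DecidableRel B.Adj] (h : ∀ i, A.degree i = B.degree i) : A = B := by
  have hdeg : ∀ (C : SimpleGraph (Fin 3)) [DecidableRel C.Adj] (i : Fin 3), C.degree i =
      (if C.Adj i 0 then 1 else 0) + (if C.Adj i 1 then 1 else 0) + if C.Adj i 2 then 1 else 0 := by
    intro C _ i
    rw [← C.card_neighborFinset_eq_degree, C.neighborFinset_eq_filter, Finset.card_filter,
      Fin.sum_univ_three]
  simp only [hdeg] at h
  have h0 := h 0
  have h1 := h 1
  have h2 := h 2
  simp only [SimpleGraph.irrefl, if_false, A.adj_comm 1 0, A.adj_comm 2 0, A.adj_comm 2 1,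
    B.adj_comm 1 0, B.adj_comm 2 0, B.adj_comm 2 1] at h0 h1 h2
  have key : ∀ (P P' : Prop) [Decidable P] [Decidable P'],
      (if P then 1 else 0 : ℕ) = (if P' then 1 else 0) → (P ↔ P') := by
    intro P P' _ _ h
    by_cases a : P <;> by_cases b : P' <;> simp_all
  have e01 : A.Adj 0 1 ↔ B.Adj 0 1 := key _ _ (by omega)
  have e02 : A.Adj 0 2 ↔ B.Adj 0 2 := key _ _ (by omega)
  have e12 : A.Adj 1 2 ↔ B.Adj 1 2 := key _ _ (by omega)
  ext i j
  fin_cases i <;> fin_cases j <;>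
    simp [A.adj_comm 1 0, A.adj_comm 2 0, A.adj_comm 2 1, B.adj_comm 1 0, B.adj_comm 2 0,
      B.adj_comm 2 1, e01, e02, e12]

/-- The degree of a vertex in the first part is the sum of the degrees into both parts. -/
theorem SimpleGraph.degree_inl_eq {α β : Type*} [Fintype α] [Fintype β] (R : SimpleGraph (α ⊕ β))
    [DecidableRel R.Adj] (a : α) [DecidableRel (R.comap Sum.inl).Adj] :
    R.degree (.inl a) = (R.comap Sum.inl : SimpleGraph α).degree a +
      (Finset.univ.filter fun b : β => R.Adj (.inl a) (.inr b)).card := by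
  simp only [← SimpleGraph.card_neighborFinset_eq_degree, SimpleGraph.neighborFinset_eq_filter,
    Finset.card_filter, Fintype.sum_sum_type, SimpleGraph.comap_adj]

theorem SimpleGraph.IsRegularOfDegree.exists_adj_inr [Fintype Q] [DecidableRel R.Adj] {r : ℕ}
    (hreg : R.IsRegularOfDegree r) (hr : 2 < r) (i : Fin 3) : ∃ w, R.Adj (.inl i) (.inr w) := by
  classical
  by_contra! hcon
  have h1 := R.degree_inl_eq i
  rw [hreg, Finset.filter_false_of_mem (fun w _ => hcon w), Finset.card_empty] at h1
  have h2 := (R.comap Sum.inl : SimpleGraph (Fin 3)).degree_lt_card_verts i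
  simp at h2
  omega

theorem SimpleGraph.deleteEdges_gadgetGraph_adj_inr {F : Set (Sym2 X)} {w : Q} {z : X ⊕ T × Q} :
    ((gadgetGraph G R p).deleteEdges (Sym2.map Sum.inl '' F)).Adj (.inr (t, w)) z ↔
      (gadgetGraph G R p).Adj (.inr (t, w)) z := by
  rw [SimpleGraph.deleteEdges_adj, and_iff_left_iff_imp]
  rintro - ⟨e, -, he⟩
  have : Sum.inr (t, w) ∈ Sym2.map (Sum.inl : X → X ⊕ T × Q) e := by rw [he]; simp
  simp at this

theorem SimpleGraph.deleteEdges_gadgetGraph_adj_inl {F : Set (Sym2 X)} {x y : X} :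
    ((gadgetGraph G R p).deleteEdges (Sym2.map Sum.inl '' F)).Adj (.inl x) (.inl y) ↔
      (G.deleteEdges F).Adj x y := by
  simp only [SimpleGraph.deleteEdges_adj]
  refine and_congr Iff.rfl (not_congr ?_)
  rw [← Sym2.map_mk, (Sym2.map.injective Sum.inl_injective).mem_set_image]

/-- An induced copy of `R` that contains a vertex of a gadget is this gadget. -/
theorem gadget_subset_range [Fintype Q] [DecidableRel R.Adj] {r : ℕ}
    (hreg : R.IsRegularOfDegree r) (hr : 2 < r) (hQ : (R.comap Sum.inr).Connected)
    {K : SimpleGraph (X ⊕ T × Q)}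
    (hK : ∀ t w z, K.Adj (.inr (t, w)) z ↔ (gadgetGraph G R p).Adj (.inr (t, w)) z)
    (ψ : R ↪g K) {v : Fin 3 ⊕ Q} {w : Q} (hv : ψ v = .inr (t, w)) :
    GadgetValid G R p t ∧ ∀ z, gadgetVertex p t z ∈ Set.range ψ := by
  classical
  have hval : GadgetValid G R p t := by
    have h1 : 0 < R.degree v := by rw [hreg]; omega
    obtain ⟨v', hv'⟩ := (R.degree_pos_iff_exists_adj v).1 h1
    have h2 := ψ.map_adj_iff.2 hv'
    rw [hv, hK, gadgetGraph_adj_inr] at h2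
    exact h2.1
  have step : ∀ (w : Q) (v : Fin 3 ⊕ Q), ψ v = .inr (t, w) → ∀ z, R.Adj (.inr w) z →
      gadgetVertex p t z ∈ Set.range ψ := by
    intro w v hv z hz
    have h1 : (R.neighborFinset v).map ψ.toEmbedding =
        (R.neighborFinset (.inr w)).map ⟨gadgetVertex p t, hval.injective⟩ := by
      refine Finset.eq_of_subset_of_card_le ?_ ?_
      · intro y hy
        simp only [Finset.mem_map, SimpleGraph.mem_neighborFinset] at hy
        obtain ⟨v', hv', rfl⟩ := hy
        have h2 := ψ.map_adj_iff.2 hv'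
        rw [hv, hK, gadgetGraph_adj_inr] at h2
        simpa using h2.2
      · simp [hreg v, hreg (.inr w)]
    have h2 : gadgetVertex p t z ∈ (R.neighborFinset v).map ψ.toEmbedding := by
      rw [h1]
      exact Finset.mem_map.2 ⟨z, by simpa using hz, rfl⟩
    simp only [Finset.mem_map] at h2
    obtain ⟨v', -, h3⟩ := h2
    exact ⟨v', h3⟩
  have hall : ∀ w' : Q, (R.comap Sum.inr).Reachable w w' →
      (.inr (t, w') : X ⊕ T × Q) ∈ Set.range ψ := by
    rintro w' ⟨W⟩
    induction W generalizing v with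
    | nil => exact ⟨v, hv⟩
    | cons hadj _ ih =>
      obtain ⟨v', hv'⟩ := step _ v hv _ hadj
      exact ih hv'
  refine ⟨hval, ?_⟩
  rintro (i | w')
  · obtain ⟨w', hw'⟩ := hreg.exists_adj_inr hr i
    obtain ⟨v', hv'⟩ := hall w' (hQ.preconnected _ _)
    exact step w' v' hv' _ hw'.symm
  · exact hall w' (hQ.preconnected _ _)

theorem EdgeDeletable.gadgetGraph [Fintype Q] [DecidableRel R.Adj] {r k : ℕ}
    (hreg : R.IsRegularOfDegree r) (hr : 2 < r) (hQ : (R.comap Sum.inr).Connected)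
    (h : EdgeDeletable (R.comap Sum.inl) G k) : EdgeDeletable R (gadgetGraph G R p) k := by
  classical
  obtain ⟨F, hF, hk, hH⟩ := h
  let ι : Sym2 X ↪ Sym2 (X ⊕ T × Q) := Function.Embedding.sym2Map ⟨Sum.inl, Sum.inl_injective⟩
  have hι : ((F.map ι : Finset (Sym2 (X ⊕ T × Q))) : Set (Sym2 (X ⊕ T × Q))) =
      Sym2.map Sum.inl '' (F : Set (Sym2 X)) := by
    rw [Finset.coe_map]
    rfl
  refine ⟨F.map ι, ?_, by simpa using hk, ?_⟩
  · rw [hι]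
    rintro _ ⟨e, he, rfl⟩
    have := hF he
    induction e with
    | _ x y => exact this
  rw [hι]
  rintro ⟨ψ⟩
  by_cases hcase : ∃ v t w, ψ v = .inr (t, w)
  · obtain ⟨v, t, w, hv⟩ := hcase
    obtain ⟨hval, hsub⟩ := gadget_subset_range hreg hr hQ
      (fun _ _ _ => SimpleGraph.deleteEdges_gadgetGraph_adj_inr) ψ hv
    choose σ hσ using hsub
    have hσi : Function.Injective σ := fun a b hab => hval.injective (by rw [← hσ, ← hσ, hab])
    let σ' : Fin 3 ⊕ Q ≃ Fin 3 ⊕ Q := Equiv.ofBijective σ (Finite.injective_iff_bijective.1 hσi)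
    let R' : SimpleGraph (Fin 3 ⊕ Q) := R.comap σ
    have hR' : ∀ a b, R'.Adj a b ↔ ((_root_.gadgetGraph G R p).deleteEdges
        (Sym2.map Sum.inl '' (F : Set (Sym2 X)))).Adj (gadgetVertex p t a)
          (gadgetVertex p t b) := by
      intro a b
      rw [← hσ a, ← hσ b, ψ.map_adj_iff]
      rfl
    let τ : R' ≃g R := ⟨σ', Iff.rfl⟩
    have hmix : ∀ i w, R'.Adj (.inl i) (.inr w) ↔ R.Adj (.inl i) (.inr w) := by
      intro i w
      rw [R'.adj_comm, R.adj_comm, hR']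
      refine SimpleGraph.deleteEdges_gadgetGraph_adj_inr.trans (gadgetGraph_adj_inr.trans ?_)
      refine ⟨?_, fun h => ⟨hval, _, h, rfl⟩⟩
      rintro ⟨-, v, h1, h2⟩
      rwa [← hval.injective h2]
    have heq : (R'.comap Sum.inl : SimpleGraph (Fin 3)) = R.comap Sum.inl := by
      refine SimpleGraph.eq_of_degree_eq_fin_three _ _ fun i => ?_
      have h1 := R'.degree_inl_eq i
      have h2 := R.degree_inl_eq i
      have h3 : R'.degree (.inl i) = R.degree (.inl i) := by
        rw [← τ.degree_eq, hreg, hreg]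
      simp only [hmix] at h1
      omega
    refine hH ⟨⟨⟨p t, fun _ _ => hval.1 _ _⟩, ?_⟩⟩
    intro i j
    rw [← heq]
    exact (SimpleGraph.deleteEdges_gadgetGraph_adj_inl (R := R) (p := p)).symm.trans
      (hR' (.inl i) (.inl j)).symm
  · have h1 : ∀ v, ∃ x, ψ v = .inl x := by
      intro v
      rcases h : ψ v with x | ⟨t, w⟩
      · exact ⟨x, rfl⟩
      · exact absurd ⟨v, t, w, h⟩ hcase
    choose f hf using h1
    refine hH ⟨⟨⟨fun i => f (.inl i), fun i j hij => ?_⟩, ?_⟩⟩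
    · have : ψ (.inl i) = ψ (.inl j) := by rw [hf, hf]; exact congrArg _ hij
      exact Sum.inl_injective (ψ.injective this)
    · intro i j
      have h2 := ψ.map_adj_iff (v := .inl i) (w := .inl j)
      rw [hf, hf] at h2
      exact SimpleGraph.deleteEdges_gadgetGraph_adj_inl.symm.trans h2

end Gadget

/-! ## The reduction -/

/-- The number of gadgets for a graph with `n` vertices: `n * n + 1` for every triple of
vertices. -/
def gadgetCount (n : ℕ) : ℕ := n * (n * (n * (n * n + 1)))

/-- The `i`-th vertex of the triple that the gadget `t` belongs to is the digit `i` of `t` in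
base `n`. -/
def gadgetTriple {n : ℕ} (t : Fin (gadgetCount n)) (i : Fin 3) : Fin n :=
  ⟨t / n ^ (i : ℕ) % n, Nat.mod_lt _ (Nat.pos_of_ne_zero fun h => by
    have := t.2
    simp [gadgetCount, h] at this)⟩

theorem lt_card_gadgetTriple {n : ℕ} (c : Fin 3 → Fin n) :
    n * n < (Finset.univ.filter fun t => gadgetTriple t = c).card := by
  have hn : 0 < n := (c 0).pos
  have hlt : ∀ {a N b : ℕ}, a < n → b < N → a + n * b < n * N := by
    intro a N b ha hb
    have := Nat.mul_le_mul_left n (Nat.succ_le_of_lt hb)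
    rw [Nat.mul_succ] at this
    omega
  let g : Fin (n * n + 1) → Fin (gadgetCount n) := fun j =>
    ⟨c 0 + n * (c 1 + n * (c 2 + n * j)), hlt (c 0).2 (hlt (c 1).2 (hlt (c 2).2 j.2))⟩
  have hg : Function.Injective g := by
    intro j j' h
    have h1 := congrArg Fin.val h
    simp only [g, Nat.add_left_cancel_iff, Nat.mul_left_cancel_iff hn] at h1
    exact Fin.ext h1
  have h1 : Finset.univ.map ⟨g, hg⟩ ⊆ Finset.univ.filter fun t => gadgetTriple t = c := by
    intro t ht
    simp only [Finset.mem_map, Finset.mem_univ, true_and, Function.Embedding.coeFn_mk] at ht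
    obtain ⟨j, rfl⟩ := ht
    have hmod : ∀ (a : Fin n) (b : ℕ), ((a : ℕ) + n * b) % n = a := fun a b => by
      rw [Nat.add_mul_mod_self_left, Nat.mod_eq_of_lt a.2]
    have hdiv : ∀ (a : Fin n) (b : ℕ), ((a : ℕ) + n * b) / n = b := fun a b => by
      rw [Nat.add_mul_div_left _ _ hn, Nat.div_eq_of_lt a.2, zero_add]
    simp only [Finset.mem_filter, Finset.mem_univ, true_and]
    funext i
    apply Fin.ext
    fin_cases i
    · simp [gadgetTriple, g, hmod]
    · simp [gadgetTriple, g, hmod, hdiv]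
    · simp [gadgetTriple, g, hmod, hdiv, pow_two, ← Nat.div_div_eq_div_mul]
  have h2 := Finset.card_le_card h1
  rw [Finset.card_map, Finset.card_univ, Fintype.card_fin] at h2
  omega

/-- The numbering of the vertices of the gadget graph. -/
def gadgetNumbering (n q : ℕ) :
    Fin (n + gadgetCount n * q) ≃ Fin n ⊕ Fin (gadgetCount n) × Fin q :=
  finSumFinEquiv.symm.trans (Equiv.sumCongr (Equiv.refl _) finProdFinEquiv.symm)

/-- The instance produced by the reduction. -/
def gadgetInstance {q : ℕ} (R : SimpleGraph (Fin 3 ⊕ Fin q)) (I : GraphInstance) :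
    GraphInstance where
  n := I.n + gadgetCount I.n * q
  G := (gadgetGraph I.G R gadgetTriple).comap (gadgetNumbering I.n q)
  k := min I.k (I.n * I.n)

section

open RAM

variable {q : ℕ} (R : SimpleGraph (Fin 3 ⊕ Fin q))

/-- `GadgetValid` in terms of the content `m` of the memory. -/
def ValidCode (n t : ℕ) (m : ℕ → ℕ) : Prop :=
  (∀ i j : Fin 3, t / n ^ (i : ℕ) % n = t / n ^ (j : ℕ) % n → i = j) ∧
    ∀ i j : Fin 3, R.Adj (.inl i) (.inl j) →
      m (t / n ^ (i : ℕ) % n * n + t / n ^ (j : ℕ) % n) ≠ 0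

/-- Adjacency of a vertex `x` of the given graph and a vertex `n + y` of a gadget. -/
def MixedCode (n x y : ℕ) (m : ℕ → ℕ) : Prop :=
  ValidCode R n (y / q) m ∧ ∃ (i : Fin 3) (w : Fin q),
    y / q / n ^ (i : ℕ) % n = x ∧ y % q = w ∧ R.Adj (.inl i) (.inr w)

/-- Adjacency in the gadget graph in terms of the content `m` of the memory. -/
def AdjCode (n u v : ℕ) (m : ℕ → ℕ) : Prop :=
  (u < n ∧ v < n ∧ m (u * n + v) ≠ 0) ∨ (u < n ∧ ¬ v < n ∧ MixedCode R n u (v - n) m) ∨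
  (¬ u < n ∧ v < n ∧ MixedCode R n v (u - n) m) ∨
  (¬ u < n ∧ ¬ v < n ∧ ValidCode R n ((u - n) / q) m ∧ (u - n) / q = (v - n) / q ∧
    ∃ w w' : Fin q, (u - n) % q = w ∧ (v - n) % q = w' ∧ R.Adj (.inr w) (.inr w'))

theorem Evaluable.digit {f : ℕ → ℕ → ℕ → (ℕ → ℕ) → ℕ} (hf : Evaluable f) (i : ℕ) :
    Evaluable fun n u v m => f n u v m / n ^ i % n := by
  have hpow : Evaluable fun n _ _ _ => n ^ i := by
    induction i with
    | zero => simpa using Evaluable.const 1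
    | succ i ih => simpa only [pow_succ] using ih.mul .reg₀
  exact (hf.div hpow).mod .reg₀

theorem testable_validCode {f : ℕ → ℕ → ℕ → (ℕ → ℕ) → ℕ} (hf : Evaluable f) :
    Testable fun n u v m => ValidCode R n (f n u v m) m :=
  (Testable.forall_fin fun _ => .forall_fin fun _ =>
    (Testable.eq (Evaluable.digit hf _) (Evaluable.digit hf _)).imp (.const _)).and
  (Testable.forall_fin fun _ => .forall_fin fun _ => (Testable.const _).imp
    (.of_evaluable (((Evaluable.digit hf _).mul .reg₀).add (Evaluable.digit hf _)).load))

theorem testable_mixedCode {f g : ℕ → ℕ → ℕ → (ℕ → ℕ) → ℕ} (hf : Evaluable f)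
    (hg : Evaluable g) : Testable fun n u v m => MixedCode R n (f n u v m) (g n u v m) m :=
  (testable_validCode R (hg.div (.const q))).and (.exists_fin fun _ => .exists_fin fun w =>
    (Testable.eq (Evaluable.digit (hg.div (.const q)) _) hf).and
      ((Testable.eq (hg.mod (.const q)) (.const w)).and (.const _)))

theorem testable_adjCode : Testable (AdjCode R) := by
  have hu := Testable.lt .reg₁ .reg₀
  have hv := Testable.lt .reg₂ .reg₀
  have eu := Evaluable.reg₁.sub .reg₀
  have ev := Evaluable.reg₂.sub .reg₀
  exact (hu.and (hv.and (.of_evaluable ((Evaluable.reg₁.mul .reg₀).add .reg₂).load))).or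
    ((hu.and (hv.not.and (testable_mixedCode R .reg₁ ev))).or
    ((hu.not.and (hv.and (testable_mixedCode R .reg₂ eu))).or
    (hu.not.and (hv.not.and ((testable_validCode R (eu.div (.const q))).and
    ((Testable.eq (eu.div (.const q)) (ev.div (.const q))).and
    (.exists_fin fun w => .exists_fin fun w' => (Testable.eq (eu.mod (.const q)) (.const w)).and
      ((Testable.eq (ev.mod (.const q)) (.const w')).and (.const _)))))))))

variable {R}

theorem validCode_iff {n : ℕ} {G : SimpleGraph (Fin n)} {t : Fin (gadgetCount n)} :
    ValidCode R n t (fun a => (adjWord G).getD a 0) ↔ GadgetValid G R gadgetTriple t := by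
  classical
  refine and_congr ?_ ?_
  · simp [gadgetTriple]
  · refine forall_congr' fun i => forall_congr' fun j => imp_congr_right fun _ => ?_
    have h := getD_adjWord G (gadgetTriple t i) (gadgetTriple t j)
    by_cases hG : G.Adj (gadgetTriple t i) (gadgetTriple t j)
    · rw [if_pos hG] at h
      exact ⟨fun _ => hG, fun _ => h.trans_ne one_ne_zero⟩
    · rw [if_neg hG] at h
      exact ⟨fun h0 => absurd h h0, fun h0 => absurd h0 hG⟩

theorem mixedCode_iff {n : ℕ} {G : SimpleGraph (Fin n)} {x : Fin n} {t : Fin (gadgetCount n)}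
    {w : Fin q} : MixedCode R n x (finProdFinEquiv (t, w)) (fun a => (adjWord G).getD a 0) ↔
      GadgetValid G R gadgetTriple t ∧ ∃ i, gadgetTriple t i = x ∧ R.Adj (.inl i) (.inr w) := by
  have hq : 0 < q := w.pos
  have h1 : ((w : ℕ) + q * t) / q = t := by
    rw [Nat.add_mul_div_left _ _ hq, Nat.div_eq_of_lt w.2, zero_add]
  have h2 : ((w : ℕ) + q * t) % q = w := by
    rw [Nat.add_mul_mod_self_left, Nat.mod_eq_of_lt w.2]
  simp only [MixedCode, finProdFinEquiv_apply_val, h1, h2, validCode_iff, gadgetTriple, Fin.ext_iff]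
  refine and_congr Iff.rfl (exists_congr fun i => ⟨?_, fun h => ⟨w, h.1, rfl, h.2⟩⟩)
  rintro ⟨w', h3, h4, h5⟩
  obtain rfl := Fin.ext h4
  exact ⟨h3, h5⟩

theorem gadgetInstance_adj_iff (I : GraphInstance) (u v : Fin (gadgetInstance R I).n) :
    (gadgetInstance R I).G.Adj u v ↔ AdjCode R I.n u v fun a => (adjWord I.G).getD a 0 := by
  classical
  obtain ⟨n, G, k⟩ := I
  obtain ⟨u, rfl⟩ := (gadgetNumbering n q).symm.surjective u
  obtain ⟨v, rfl⟩ := (gadgetNumbering n q).symm.surjective v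
  have hl : ∀ x : Fin n, (((gadgetNumbering n q).symm (.inl x) : Fin _) : ℕ) = x := by
    simp [gadgetNumbering]
  have hr : ∀ z, (((gadgetNumbering n q).symm (.inr z) : Fin _) : ℕ) = n + finProdFinEquiv z := by
    simp [gadgetNumbering]
  have hadj : (gadgetInstance R ⟨n, G, k⟩).G.Adj ((gadgetNumbering n q).symm u)
      ((gadgetNumbering n q).symm v) ↔ (gadgetGraph G R gadgetTriple).Adj u v := by
    simp [gadgetInstance]
  refine hadj.trans ?_
  rcases u with x | ⟨t, w⟩ <;> rcases v with y | ⟨t', w'⟩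
  · rw [hl, hl]
    have h1 : (gadgetGraph G R gadgetTriple).Adj (.inl x) (.inl y) ↔ G.Adj x y := Iff.rfl
    simp only [AdjCode, x.2, y.2, not_true, false_and, true_and, and_false, or_false, h1,
      getD_adjWord]
    simp
  · rw [hl, hr]
    have h1 : ¬ n + (finProdFinEquiv (t', w') : ℕ) < n := by omega
    simp only [AdjCode, x.2, h1, not_true, not_false_eq_true, false_and, true_and, or_false,
      false_or, Nat.add_sub_cancel_left]
    exact mixedCode_iff.symm
  · rw [hl, hr]
    have h1 : ¬ n + (finProdFinEquiv (t, w) : ℕ) < n := by omega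
    simp only [AdjCode, y.2, h1, not_true, not_false_eq_true, false_and, true_and, or_false,
      false_or, Nat.add_sub_cancel_left]
    exact mixedCode_iff.symm
  · rw [hr, hr]
    have h1 : ∀ a, ¬ n + a < n := by
      intro a
      omega
    have hq : 0 < q := w.pos
    have h2 : ∀ (t : ℕ) (w : Fin q), ((w : ℕ) + q * t) / q = t := fun t w => by
      rw [Nat.add_mul_div_left _ _ hq, Nat.div_eq_of_lt w.2, zero_add]
    have h3 : ∀ (t : ℕ) (w : Fin q), ((w : ℕ) + q * t) % q = w := fun t w => by
      rw [Nat.add_mul_mod_self_left, Nat.mod_eq_of_lt w.2]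
    simp only [AdjCode, h1, not_false_eq_true, false_and, true_and, false_or,
      Nat.add_sub_cancel_left, finProdFinEquiv_apply_val, h2, h3, validCode_iff]
    refine and_congr Iff.rfl (and_congr Fin.ext_iff ⟨fun h => ⟨w, w', rfl, rfl, h⟩, ?_⟩)
    rintro ⟨a, b, ha, hb, h⟩
    obtain rfl := Fin.ext ha
    obtain rfl := Fin.ext hb
    exact h

theorem polyTimeComputable_gadgetInstance :
    PolyTimeComputable GraphInstance.encode GraphInstance.encode (gadgetInstance R) := by
  refine GraphInstance.polyTimeComputable (g := fun n => n + gadgetCount n * q) ?_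
    (testable_adjCode R) _ (fun _ => rfl) (fun _ => rfl) gadgetInstance_adj_iff
  have h := Evaluable.reg₀
  exact h.add ((h.mul (h.mul (h.mul ((h.mul h).add (.const 1))))).mul (.const q))

end

theorem edgeDeletable_min_iff {V : Type*} {H : SimpleGraph V} {n k : ℕ}
    {G : SimpleGraph (Fin n)} : EdgeDeletable H G (min k (n * n)) ↔ EdgeDeletable H G k := by
  classical
  refine ⟨fun ⟨F, h1, h2, h3⟩ => ⟨F, h1, h2.trans (min_le_left _ _), h3⟩,
    fun ⟨F, h1, h2, h3⟩ => ⟨F, h1, le_min h2 ?_, h3⟩⟩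
  have h4 : F.card ≤ G.edgeFinset.card := Finset.card_le_card (by
    intro e he
    simpa using h1 he)
  have h5 := G.card_edgeFinset_le_card_choose_two
  rw [Fintype.card_fin, Nat.choose_two_right] at h5
  have h6 : n * (n - 1) / 2 ≤ n * n :=
    (Nat.div_le_self _ _).trans (Nat.mul_le_mul_left _ (Nat.sub_le _ _))
  omega

theorem edgeDeletable_gadgetInstance_iff {q : ℕ} {R : SimpleGraph (Fin 3 ⊕ Fin q)}
    [DecidableRel R.Adj] {r : ℕ} (hreg : R.IsRegularOfDegree r) (hr : 2 < r)
    (hQ : (R.comap Sum.inr).Connected) (I : GraphInstance) :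
    EdgeDeletable R (gadgetInstance R I).G (gadgetInstance R I).k ↔
      EdgeDeletable (R.comap Sum.inl) I.G I.k := by
  let f : (gadgetInstance R I).G ≃g gadgetGraph I.G R gadgetTriple :=
    ⟨gadgetNumbering I.n q, Iff.rfl⟩
  rw [← edgeDeletable_min_iff (G := I.G)]
  refine ⟨fun h => ?_, fun h => ?_⟩
  · exact (h.of_iso SimpleGraph.Iso.refl f).of_gadgetGraph fun c =>
      (min_le_right _ _).trans_lt (lt_card_gadgetTriple c)
  · exact (h.gadgetGraph hreg hr hQ).of_iso SimpleGraph.Iso.refl f.symm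

theorem mainTheorem12 {V : Type*} [Fintype V] (R : SimpleGraph V) [DecidableRel R.Adj]
    (r : ℕ) (hr : 2 < r) (hreg : R.IsRegularOfDegree r) (hconn : R.Connected)
    (V' : Set V)
    (hV' : Nonempty (R.induce V' ≃g SimpleGraph.pathGraph 3) ∨
      Nonempty (R.induce V' ≃g SimpleGraph.completeGraph (Fin 3)))
    (hcompl : (R.induce V'ᶜ).Connected) :
    LinearParamReducible (edgeDeletion (R.induce V')) (edgeDeletion R) := by
  classical
  obtain ⟨e₁⟩ : Nonempty (V' ≃ Fin 3) := by
    rcases hV' with ⟨⟨e⟩⟩ | ⟨⟨e⟩⟩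
    · exact ⟨e.toEquiv⟩
    · exact ⟨e.toEquiv⟩
  obtain ⟨q, ⟨e₂⟩⟩ := Finite.exists_equiv_fin (V'ᶜ : Set V)
  let e : Fin 3 ⊕ Fin q ≃ V := (Equiv.sumCongr e₁.symm e₂.symm).trans (Equiv.Set.sumCompl V')
  let R₀ : SimpleGraph (Fin 3 ⊕ Fin q) := R.comap e
  let φ : R₀ ≃g R := ⟨e, Iff.rfl⟩
  let φ₁ : R₀.comap Sum.inl ≃g R.induce V' := ⟨e₁.symm, Iff.rfl⟩
  let φ₂ : R₀.comap Sum.inr ≃g R.induce V'ᶜ := ⟨e₂.symm, Iff.rfl⟩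
  have hreg₀ : R₀.IsRegularOfDegree r := fun v => by rw [← φ.degree_eq, hreg]
  have hiff := edgeDeletable_gadgetInstance_iff hreg₀ hr (φ₂.connected_iff.2 hcompl)
  refine ⟨gadgetInstance R₀, polyTimeComputable_gadgetInstance, fun I => ⟨fun h => ?_, fun h => ?_⟩,
    1, fun I => ?_⟩
  · exact ((hiff I).2 (EdgeDeletable.of_iso h φ₁.symm SimpleGraph.Iso.refl)).of_iso φ
      SimpleGraph.Iso.refl
  · exact ((hiff I).1 (EdgeDeletable.of_iso h φ.symm SimpleGraph.Iso.refl)).of_iso φ₁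
      SimpleGraph.Iso.refl
  · rw [one_mul]
    exact min_le_left _ _
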